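/- Consider two tiers of base stations (BSs) in the plane and a user at the origin. Tier $i\in\{1,2\}$ has transmit power $P_i>0$, path-loss exponent $\alpha_i>0$, BS density $\lambda_i>0$, activity probability $p_{{\rm a},i}\in(0,1]$ and $M_i\ge 1$ antennas ($M_i$ an integer). Suppose that the user is served by a BS of tier $k\in\{1,2\}$ at distance $r>0$. Model the other active BSs of the two tiers as independent homogeneous Poisson point processes, with density $p_{{\rm a},i}\lambda_i$ in tier $i$, and let the fading gains $h_{i,n}$ of the BSs at the points $x_{i,n}$ of tier $i$ be i.i.d. ${\rm Gamma}(M_i,\tfrac1{M_i})$ (shape $M_i$, scale $1/M_i$, unit mean), independent of the locations and independent between tiers. The user is associated with the BS of strongest average received power, so condition on the event (which has positive probability) that $P_i\|x_{i,n}\|^{-\alpha_i}\le P_k r^{-\alpha_k}$ for all $i$ and $n$. Let $j\in\{1,2\}$ with $\alpha_j>2$, and put $\widehat P_j=P_j/P_k$, $\widehat\alpha_j=\alpha_j/\alpha_k$. Then, conditionally on this event, almost surely all these BSs of tier $j$ are at distance at least $r_{0,j}=\widehat P_j^{1/\alpha_j}r^{1/\widehat\alpha_j}$ from the user, the interference $I_{k,j}=\sum_n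 P_j h_{j,n}\|x_{j,n}\|^{-\alpha_j}$ is finite, and its conditional Laplace transform $\mathcal L_{I_{k,j}}(s)=\mathbb E[e^{-sI_{k,j}}]$ is, for every real $s\ge 0$, $$\mathcal L_{I_{k,j}}(s)=\exp\Big(-\pi p_{{\rm a},j}\lambda_j\,\widehat P_j^{2/\alpha_j}\,r^{2/\widehat\alpha_j}\Big({}_2F_1\Big[-\tfrac{2}{\alpha_j},M_j;1-\tfrac{2}{\alpha_j};-\tfrac{sP_j}{M_j\widehat P_j}r^{-\alpha_k}\Big]-1\Big)\Big),$$ where ${}_2F_1$ is the Gauss hypergeometric function on $\mathbb C\setminus[1,\infty)$, i.e. the analytic continuation of the hypergeometric series from the unit disc. -/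

import Mathlib

open MeasureTheory ProbabilityTheory

noncomputable section

/-! ### The Gauss hypergeometric function on the cut plane -/

/-- The complex plane cut along `[1, ∞)`, i.e. `ℂ ∖ [1, ∞)`. -/
def cutPlane : Set ℂ := {z | 1 - z ∈ Complex.slitPlane}

/-- `F` is the principal branch of the Gauss hypergeometric function with parameters `a b c`: it is
holomorphic on `ℂ ∖ [1, ∞)` and is given on the open unit disc by the power series
`∑ (a)ₙ (b)ₙ / (c)ₙ zⁿ / n!`. -/
structure IsGaussHypergeometric (a b c : ℂ) (F : ℂ → ℂ) : Prop where
  differentiableOn : DifferentiableOn ℂ F cutPlane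
  eq_series : ∀ z : ℂ, ‖z‖ < 1 → F z = ordinaryHypergeometric a b c z

theorem isOpen_cutPlane : IsOpen cutPlane :=
  Complex.isOpen_slitPlane.preimage (by fun_prop : Continuous fun z : ℂ => 1 - z)

theorem isPreconnected_cutPlane : IsPreconnected cutPlane := by
  have h : IsPreconnected ((fun z : ℂ => 1 - z) '' Complex.slitPlane) :=
    (Complex.starConvex_one_slitPlane.isPathConnected
      Complex.one_mem_slitPlane).isConnected.isPreconnected.image _ (by fun_prop)
  convert h using 1
  ext z
  constructor
  · intro hz
    exact ⟨1 - z, hz, by simp⟩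
  · rintro ⟨w, hw, rfl⟩
    simpa [cutPlane] using hw

/-- The principal branch is unique on the cut plane. -/
theorem IsGaussHypergeometric.eqOn {a b c : ℂ} {F G : ℂ → ℂ}
    (hF : IsGaussHypergeometric a b c F) (hG : IsGaussHypergeometric a b c G) :
    Set.EqOn F G cutPlane := by
  refine (hF.differentiableOn.analyticOnNhd isOpen_cutPlane).eqOn_of_preconnected_of_eventuallyEq
    (hG.differentiableOn.analyticOnNhd isOpen_cutPlane) isPreconnected_cutPlane
    (z₀ := 0) (by simp [cutPlane]) ?_
  filter_upwards [Metric.ball_mem_nhds (0 : ℂ) one_pos] with z hz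
  have hz' : ‖z‖ < 1 := by simpa using hz
  rw [hF.eq_series z hz', hG.eq_series z hz']

open Classical in
/-- The Gauss hypergeometric function `₂F₁[a, b; c; z]` on `ℂ ∖ [1, ∞)`: the analytic continuation
of the hypergeometric series from the unit disc. (Mathlib's `ordinaryHypergeometric` is only the
sum of the series, which is a default value outside the unit disc.) -/
def gaussHypergeometric (a b c z : ℂ) : ℂ :=
  if h : ∃ F : ℂ → ℂ, IsGaussHypergeometric a b c F then h.choose z
  else ordinaryHypergeometric a b c z

/-! ### Poisson point processes in the plane -/

/-- The Euclidean plane. -/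
abbrev Plane : Type := EuclideanSpace ℝ (Fin 2)

section Model

variable {Ω : Type*} [MeasurableSpace Ω]

/-- The number of indices `n` for which the random point `X n` lies in `B`. -/
def pointCount (X : ℕ → Ω → Plane) (B : Set Plane) (ω : Ω) : ℕ∞ :=
  {n : ℕ | X n ω ∈ B}.encard

/-- The random points `X 0, X 1, …` enumerate a homogeneous Poisson point process of density `d > 0`
(points per unit area) in the plane: the number of points in a Borel set of finite area is Poisson
distributed with mean `d` times the area, and the numbers of points in disjoint sets are
independent. -/
structure IsHomogeneousPPP (X : ℕ → Ω → Plane) (d : ℝ) (μ : Measure Ω) : Prop where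
  density_pos : 0 < d
  measurable : ∀ n, Measurable (X n)
  hasLaw_count : ∀ B : Set Plane, MeasurableSet B → volume B ≠ ⊤ →
    HasLaw (pointCount X B)
      ((poissonMeasure (d.toNNReal * (volume B).toNNReal)).map (Nat.cast : ℕ → ℕ∞)) μ
  indep_count : ∀ (m : ℕ) (B : Fin m → Set Plane), (∀ i, MeasurableSet (B i)) →
    (∀ i, volume (B i) ≠ ⊤) → Pairwise (fun i i' => Disjoint (B i) (B i')) →
    iIndepFun (fun i => pointCount X (B i)) μ

/-! ### The two-tier network seen from a user at the origin -/

/-- The active base stations of the two tiers other than the one serving the user, together with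
their fading gains. In tier `i` they are located at `X i 0, X i 1, …`, which is a homogeneous
Poisson point process of density `d i`; the gain of the station at `X i n` is `h i n`. The gains of
tier `i` are independent of each other and of the locations, and have the Gamma distribution with
shape `M i` and scale `1 / M i` (rate `M i`, hence unit mean). The two tiers are independent. -/
structure IsTwoTierNetwork (X : Fin 2 → ℕ → Ω → Plane) (h : Fin 2 → ℕ → Ω → ℝ)
    (d : Fin 2 → ℝ) (M : Fin 2 → ℕ) (μ : Measure Ω) : Prop where
  ppp : ∀ i, IsHomogeneousPPP (X i) (d i) μ
  measurable_fading : ∀ i n, Measurable (h i n)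
  fading_law : ∀ i n, HasLaw (h i n) (gammaMeasure (M i) (M i)) μ
  fading_indep : ∀ i, iIndepFun (h i) μ
  location_fading_indep : ∀ i, IndepFun (fun ω n => X i n ω) (fun ω n => h i n ω) μ
  tier_indep : iIndepFun (β := fun _ : Fin 2 => (ℕ → Plane) × (ℕ → ℝ))
    (fun i ω => (fun n => X i n ω, fun n => h i n ω)) μ

/-- The event that a user at the origin whose serving station belongs to tier `k` and is at distance
`r` is associated with it: no other active station, of either tier, is received with larger average
power (transmit power `P i`, path-loss exponent `α i` in tier `i`). -/
def associationEvent (P α : Fin 2 → ℝ) (X : Fin 2 → ℕ → Ω → Plane) (k : Fin 2) (r : ℝ) : Set Ω :=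
  {ω | ∀ i n, P i * ‖X i n ω‖ ^ (-α i) ≤ P k * r ^ (-α k)}

/-- The interference power at the origin caused by the active non-serving stations of tier `j`. -/
def interference (P α : Fin 2 → ℝ) (X : Fin 2 → ℕ → Ω → Plane) (h : Fin 2 → ℕ → Ω → ℝ)
    (j : Fin 2) (ω : Ω) : ℝ :=
  ∑' n, P j * h j n ω * ‖X j n ω‖ ^ (-α j)

end Model

end

/-! Expectations are taken in `[0, ∞]` with `e^{-∞} = 0`. Charging the cost `∞` to points of a
forbidden region restricts the Laplace functional of a Poisson process to the event that the region
is empty, so the association event enters as part of the functional itself. That event is the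
intersection of one void event per tier; by independence of the tiers, the probability of the other
tier's void event cancels on conditioning.

The functional is built from the laws of the counts, through simple functions and monotone limits
(`IsHomogeneousPPP.lintegral_negExp_tsum`), and independent marks are integrated out point by point
(`IsHomogeneousPPP.lintegral_negExp_tsum_marked`). A Gamma mark gives `E e^{-yh} = (1 + y/M)^{-M}`.
With `c = sP/M` and `ρ` the exclusion radius, the exponent is therefore minus the density times the
integral of `1 - (1 + c‖x‖^{-α})^{-M}` over `‖x‖ ≥ ρ`.

Polar coordinates and `u = (ρ/‖x‖)^α` turn this integral into `πρ²δ ∫₀¹ u^{-δ-1}(1 - (1 + yu)^{-M})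
du`, where `δ = 2/α` and `y = cρ^{-α}`. A geometric sum extracts a factor `u`, leaving Euler
integrals that converge because `δ < 1`. They are holomorphic on the cut plane and produce the
hypergeometric series in the disc, so the identity theorem gives `₂F₁` at `-y`. Finiteness of the
interference comes from letting `s → 0` in the Laplace transform. -/

open Filter Topology
open scoped ENNReal NNReal

/-! ### The exponential `e^{-x}` on `[0, ∞]` -/

/-- The function `x ↦ e^{-x}` on `[0, ∞]`, with value `0` at `∞`. -/
noncomputable def negExp (x : ℝ≥0∞) : ℝ≥0∞ := EReal.exp (-(x : EReal))

@[simp] theorem negExp_zero : negExp 0 = 1 := by simp [negExp]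

@[simp] theorem negExp_top : negExp ∞ = 0 := by simp [negExp]

theorem negExp_ofReal {x : ℝ} (hx : 0 ≤ x) :
    negExp (ENNReal.ofReal x) = ENNReal.ofReal (Real.exp (-x)) := by
  rw [negExp, EReal.coe_ennreal_ofReal, max_eq_left hx, ← EReal.coe_neg, EReal.exp_coe]

theorem negExp_add (x y : ℝ≥0∞) : negExp (x + y) = negExp x * negExp y := by
  rw [negExp, negExp, negExp, ← EReal.exp_add, EReal.coe_ennreal_add, EReal.neg_add, sub_eq_add_neg]
  · left; simp
  · right; simp

theorem antitone_negExp : Antitone negExp := fun x y h => by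
  unfold negExp
  apply EReal.exp_monotone
  rw [EReal.neg_le_neg_iff]
  exact_mod_cast h

theorem continuous_negExp : Continuous negExp :=
  ENNReal.continuous_exp.comp (continuous_neg.comp continuous_coe_ennreal_ereal)

@[fun_prop] theorem measurable_negExp : Measurable negExp := continuous_negExp.measurable

theorem negExp_le_one (x : ℝ≥0∞) : negExp x ≤ 1 := by
  simpa using antitone_negExp (zero_le (a := x))

theorem negExp_ne_top (x : ℝ≥0∞) : negExp x ≠ ∞ :=
  ((negExp_le_one x).trans_lt ENNReal.one_lt_top).ne

theorem negExp_ne_zero {x : ℝ≥0∞} (hx : x ≠ ∞) : negExp x ≠ 0 := by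
  simpa [negExp] using hx

theorem negExp_sum {ι : Type*} (s : Finset ι) (f : ι → ℝ≥0∞) :
    negExp (∑ i ∈ s, f i) = ∏ i ∈ s, negExp (f i) := by
  classical
  induction s using Finset.induction_on with
  | empty => simp
  | insert a s ha ih => rw [Finset.sum_insert ha, Finset.prod_insert ha, negExp_add, ih]

theorem tendsto_prod_negExp (f : ℕ → ℝ≥0∞) :
    Tendsto (fun N => ∏ n ∈ Finset.range N, negExp (f n)) atTop (𝓝 (negExp (∑' n, f n))) := by
  simp_rw [← negExp_sum]
  exact (continuous_negExp.tendsto _).comp ENNReal.summable.hasSum.tendsto_sum_nat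

/-- Used to rewrite the Laplace transform of a mark as `e^{-G(x)}` for a cost `G` depending on the
location alone. -/
theorem exists_negExp_eq {y : ℝ≥0∞} (hy : y ≤ 1) :
    negExp ((-(ENNReal.log y)).toENNReal) = y := by
  rw [negExp, EReal.coe_toENNReal, neg_neg, ENNReal.exp_log]
  rw [EReal.neg_nonneg]
  simpa using hy

theorem lintegral_negExp_le_one {α : Type*} [MeasurableSpace α] (μ : Measure α)
    [IsProbabilityMeasure μ] (f : α → ℝ≥0∞) : ∫⁻ x, negExp (f x) ∂μ ≤ 1 :=
  (lintegral_mono fun x => negExp_le_one (f x)).trans (by simp)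

theorem tendsto_lintegral_of_le_one {α : Type*} [MeasurableSpace α] (μ : Measure α)
    [IsProbabilityMeasure μ] {F : ℕ → α → ℝ≥0∞} {f : α → ℝ≥0∞} (hF : ∀ n, Measurable (F n))
    (h1 : ∀ n x, F n x ≤ 1) (h : ∀ x, Tendsto (fun n => F n x) atTop (𝓝 (f x))) :
    Tendsto (fun n => ∫⁻ x, F n x ∂μ) atTop (𝓝 (∫⁻ x, f x ∂μ)) :=
  tendsto_lintegral_of_dominated_convergence (fun _ => 1) hF
    (fun n => Eventually.of_forall (h1 n)) (by simp) (Eventually.of_forall h)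

/-! ### Laplace functionals of Poisson processes, without and with marks -/

/-- The Laplace transform of the Poisson distribution. -/
theorem lintegral_negExp_poissonMeasure (l : ℝ≥0) (c : ℝ≥0) :
    ∫⁻ n : ℕ, negExp (c * n) ∂(poissonMeasure l) = negExp (l * (1 - negExp c)) := by
  have hc : negExp c = ENNReal.ofReal (Real.exp (-c)) := by
    rw [← negExp_ofReal (NNReal.coe_nonneg c), ENNReal.ofReal_coe_nnreal]
  have hc1 : Real.exp (-(c : ℝ)) ≤ 1 := by simp
  have key : ∀ n : ℕ, negExp (c * n) * poissonMeasure l {n} =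
      ENNReal.ofReal (Real.exp (-l) * ((l * Real.exp (-c)) ^ n / n.factorial)) := by
    intro n
    have : (c * n : ℝ≥0∞) = ENNReal.ofReal (c * n) := by
      rw [ENNReal.ofReal_mul (NNReal.coe_nonneg c)]; simp
    rw [this, negExp_ofReal (by positivity), poissonMeasure_singleton,
      ← ENNReal.ofReal_mul (by positivity)]
    congr 1
    rw [mul_pow, ← Real.exp_nat_mul]
    ring_nf
  rw [lintegral_countable']
  simp_rw [key]
  have hs := (NormedSpace.expSeries_div_hasSum_exp (l * Real.exp (-c) : ℝ)).mul_left (Real.exp (-l))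
  rw [← ENNReal.ofReal_tsum_of_nonneg (fun n => by positivity) hs.summable, hs.tsum_eq,
    ← Real.exp_eq_exp_ℝ, ← Real.exp_add, hc, ← ENNReal.ofReal_one,
    ← ENNReal.ofReal_sub _ (Real.exp_pos _).le, ← ENNReal.ofReal_coe_nnreal (p := l),
    ← ENNReal.ofReal_mul (NNReal.coe_nonneg l),
    negExp_ofReal (mul_nonneg (NNReal.coe_nonneg l) (by linarith))]
  congr 2
  ring

theorem coe_pointCount {Ω : Type*} [MeasurableSpace Ω] (X : ℕ → Ω → Plane) (B : Set Plane) (ω : Ω) :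
    (pointCount X B ω : ℝ≥0∞) = ∑' n, B.indicator (fun _ => 1) (X n ω) := by
  rw [pointCount, ← ENNReal.tsum_set_one, tsum_subtype {n | X n ω ∈ B} (fun _ => (1 : ℝ≥0∞))]
  rfl

namespace IsHomogeneousPPP

variable {Ω : Type*} [MeasurableSpace Ω] {μ : Measure Ω} {X : ℕ → Ω → Plane} {d : ℝ}

theorem lintegral_negExp_pointCount (hX : IsHomogeneousPPP X d μ) {B : Set Plane}
    (hB : MeasurableSet B) (hB' : volume B ≠ ∞) (c : ℝ≥0) :
    ∫⁻ ω, negExp (c * (pointCount X B ω : ℝ≥0∞)) ∂μ =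
      negExp (ENNReal.ofReal d * (volume B * (1 - negExp c))) := by
  have h := hX.hasLaw_count B hB hB'
  have hm : Measurable fun n : ℕ∞ => negExp (c * (n : ℝ≥0∞)) := Measurable.of_discrete
  rw [← lintegral_map' (f := fun n : ℕ∞ => negExp (c * (n : ℝ≥0∞))) hm.aemeasurable h.aemeasurable,
    h.map_eq, lintegral_map hm Measurable.of_discrete]
  simp only [ENat.toENNReal_coe]
  rw [lintegral_negExp_poissonMeasure, ENNReal.coe_mul, ENNReal.coe_toNNReal hB', mul_assoc]
  rfl

theorem measurable_coe_pointCount (hX : IsHomogeneousPPP X d μ) {B : Set Plane}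
    (hB : MeasurableSet B) : Measurable fun ω => (pointCount X B ω : ℝ≥0∞) := by
  simp_rw [coe_pointCount]
  exact Measurable.tsum fun n =>
    (measurable_const.indicator hB).comp (hX.measurable n)

/-- The Laplace transform of a linear combination of the counts in disjoint sets. -/
theorem lintegral_negExp_sum_pointCount (hX : IsHomogeneousPPP X d μ) {m : ℕ}
    {B : Fin m → Set Plane} (hB : ∀ i, MeasurableSet (B i)) (hB' : ∀ i, volume (B i) ≠ ∞)
    (hd : Pairwise fun i i' => Disjoint (B i) (B i')) (c : Fin m → ℝ≥0) :
    ∫⁻ ω, negExp (∑ i, c i * (pointCount X (B i) ω : ℝ≥0∞)) ∂μ =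
      negExp (ENNReal.ofReal d * ∑ i, volume (B i) * (1 - negExp (c i))) := by
  have hind := (hX.indep_count m B hB hB' hd).comp (fun i n => negExp (c i * (n : ℝ≥0∞)))
    (fun i => Measurable.of_discrete)
  simp_rw [negExp_sum]
  rw [lintegral_prod_eq_prod_lintegral_of_indepFun Finset.univ
    (fun i ω => negExp (c i * (pointCount X (B i) ω : ℝ≥0∞))) hind
    (fun i => measurable_negExp.comp ((hX.measurable_coe_pointCount (hB i)).const_mul _)),
    Finset.mul_sum, negExp_sum]
  exact Finset.prod_congr rfl fun i _ => hX.lintegral_negExp_pointCount (hB i) (hB' i) (c i)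

/-- The nonzero level sets of `G` are disjoint and of finite area, so the sum over the points is a
linear combination of independent Poisson counts. -/
theorem lintegral_negExp_tsum_simpleFunc (hX : IsHomogeneousPPP X d μ)
    (G : SimpleFunc Plane ℝ≥0∞) (hG : ∀ x, G x ≠ ∞) (hG' : volume (Function.support G) ≠ ∞) :
    ∫⁻ ω, negExp (∑' n, G (X n ω)) ∂μ =
      negExp (ENNReal.ofReal d * ∫⁻ x, 1 - negExp (G x)) := by
  classical
  -- The value `0` is dropped: its level set has infinite area and contributes to neither side.
  set S := G.range.filter (· ≠ 0)
  let e : Fin S.card ≃ S := S.equivFin.symm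
  let B : Fin S.card → Set Plane := fun i => G ⁻¹' {(e i : ℝ≥0∞)}
  have hB : ∀ i, MeasurableSet (B i) := fun i => G.measurableSet_preimage _
  have hS : ∀ i, (e i : ℝ≥0∞) ∈ G.range ∧ (e i : ℝ≥0∞) ≠ 0 := fun i =>
    Finset.mem_filter.1 (e i).2
  have hfin : ∀ i, (((e i : ℝ≥0∞).toNNReal : ℝ≥0) : ℝ≥0∞) = e i := fun i => by
    obtain ⟨x, hx⟩ := SimpleFunc.mem_range.1 (hS i).1
    exact ENNReal.coe_toNNReal (hx ▸ hG x)
  have hB' : ∀ i, volume (B i) ≠ ∞ := fun i => by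
    refine measure_ne_top_of_subset (fun x hx => ?_) hG'
    have hx : G x = e i := hx
    simpa [hx] using (hS i).2
  have hd : Pairwise fun i i' => Disjoint (B i) (B i') := fun i i' hii' => by
    refine Set.disjoint_left.2 fun x hx hx' => hii' (e.injective (Subtype.ext ?_))
    exact (show G x = e i from hx).symm.trans hx'
  have key : ∀ (g : ℝ≥0∞ → ℝ≥0∞), g 0 = 0 → ∀ x,
      g (G x) = ∑ i, g (e i) * (B i).indicator (fun _ => 1) x := by
    intro g hg x
    have h1 : ∑ i, g (e i) * (B i).indicator (fun _ => 1) x =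
        ∑ v ∈ S, if G x = v then g v else 0 := by
      rw [← Finset.sum_coe_sort S, ← e.sum_comp]
      refine Finset.sum_congr rfl fun i _ => ?_
      simp [B, Set.indicator_apply]
    rw [h1, Finset.sum_ite_eq]
    split_ifs with h
    · rfl
    · have : G x = 0 := by simpa [S] using h
      rw [this, hg]
  have h1 : ∀ ω, ∑' n, G (X n ω) =
      ∑ i, ((e i : ℝ≥0∞).toNNReal : ℝ≥0∞) * (pointCount X (B i) ω : ℝ≥0∞) := by
    intro ω
    simp_rw [hfin, coe_pointCount, ← ENNReal.tsum_mul_left]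
    rw [← Summable.tsum_finsetSum fun _ _ => ENNReal.summable]
    exact tsum_congr fun n => key id rfl _
  have h2 : ∫⁻ x, 1 - negExp (G x) = ∑ i, volume (B i) *
      (1 - negExp (((e i : ℝ≥0∞).toNNReal : ℝ≥0) : ℝ≥0∞)) := by
    simp_rw [hfin]
    rw [lintegral_congr (key (fun v => 1 - negExp v) (by simp)),
      lintegral_finsetSum _ fun i _ => (measurable_const.indicator (hB i)).const_mul _]
    refine Finset.sum_congr rfl fun i _ => ?_
    rw [lintegral_const_mul _ (measurable_const.indicator (hB i)),
      lintegral_indicator_const (hB i), one_mul, mul_comm]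
  simp_rw [h1]
  rw [h2]
  exact hX.lintegral_negExp_sum_pointCount hB hB' hd _

/-- The Laplace functional of a homogeneous Poisson process. -/
theorem lintegral_negExp_tsum [IsProbabilityMeasure μ] (hX : IsHomogeneousPPP X d μ)
    {G : Plane → ℝ≥0∞} (hG : Measurable G) :
    ∫⁻ ω, negExp (∑' n, G (X n ω)) ∂μ =
      negExp (ENNReal.ofReal d * ∫⁻ x, 1 - negExp (G x)) := by
  let K : ℕ → Set Plane := fun m => Metric.ball 0 m
  have hK : ∀ m, MeasurableSet (K m) := fun m => Metric.isOpen_ball.measurableSet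
  -- `SimpleFunc.eapprox` keeps the values finite and the restriction to balls keeps the support of
  -- finite area, as the simple case requires.
  let g : ℕ → SimpleFunc Plane ℝ≥0∞ := fun m => (SimpleFunc.eapprox G m).restrict (K m)
  have hg : ∀ m x, g m x = (K m).indicator (SimpleFunc.eapprox G m) x := fun m x =>
    SimpleFunc.restrict_apply _ (hK m) x
  have hmono : ∀ x, Monotone fun m => g m x := by
    intro x m m' h
    simp only [hg]
    refine (Set.indicator_le_indicator (SimpleFunc.monotone_eapprox G h x)).trans
      (Set.indicator_le_indicator_of_subset
        (Metric.ball_subset_ball (by exact_mod_cast h)) (fun _ => zero_le) x)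
  have hlim : ∀ x, Tendsto (fun m => g m x) atTop (𝓝 (G x)) := by
    intro x
    refine (SimpleFunc.tendsto_eapprox hG x).congr' ?_
    obtain ⟨N, hN⟩ := exists_nat_gt ‖x‖
    filter_upwards [eventually_ge_atTop N] with m hm
    rw [hg, Set.indicator_of_mem]
    have : (N : ℝ) ≤ m := by exact_mod_cast hm
    simpa [K] using hN.trans_le this
  have hsup : ∀ x, ⨆ m, g m x = G x := fun x => iSup_eq_of_tendsto (hmono x) (hlim x)
  have hfin : ∀ m, ∫⁻ ω, negExp (∑' n, g m (X n ω)) ∂μ =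
      negExp (ENNReal.ofReal d * ∫⁻ x, 1 - negExp (g m x)) := by
    intro m
    refine hX.lintegral_negExp_tsum_simpleFunc (g m) (fun x => ?_) ?_
    · rw [hg]
      by_cases hx : x ∈ K m
      · rw [Set.indicator_of_mem hx]; exact (SimpleFunc.eapprox_lt_top G m x).ne
      · rw [Set.indicator_of_notMem hx]; simp
    · refine measure_ne_top_of_subset (s := K m) (fun x hx => ?_)
        (measure_ball_lt_top (μ := volume) (x := (0 : Plane))).ne
      by_contra h
      exact hx (by rw [hg, Set.indicator_of_notMem h])
  have hL : Tendsto (fun m => ∫⁻ ω, negExp (∑' n, g m (X n ω)) ∂μ) atTop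
      (𝓝 (∫⁻ ω, negExp (∑' n, G (X n ω)) ∂μ)) := by
    refine tendsto_lintegral_of_le_one μ (fun m => ?_) (fun m ω => negExp_le_one _) fun ω => ?_
    · exact measurable_negExp.comp
        (Measurable.tsum fun n => (g m).measurable.comp (hX.measurable n))
    · refine (continuous_negExp.tendsto _).comp ?_
      have : ∑' n, G (X n ω) = ⨆ m, ∑' n, g m (X n ω) := by
        simp_rw [← lintegral_count, ← hsup]
        exact lintegral_iSup (fun m => measurable_from_top) fun m m' h n => hmono (X n ω) h
      rw [this]
      exact tendsto_atTop_iSup fun m m' h => ENNReal.tsum_le_tsum fun n => hmono (X n ω) h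
  have hR : Tendsto (fun m => negExp (ENNReal.ofReal d * ∫⁻ x, 1 - negExp (g m x))) atTop
      (𝓝 (negExp (ENNReal.ofReal d * ∫⁻ x, 1 - negExp (G x)))) := by
    refine (continuous_negExp.tendsto _).comp (ENNReal.Tendsto.const_mul ?_ (Or.inr (by simp)))
    refine lintegral_tendsto_of_tendsto_of_monotone (fun m => ?_) (ae_of_all _ fun x m m' h => ?_)
      (ae_of_all _ fun x => ?_)
    · exact ((measurable_negExp.comp (g m).measurable).const_sub 1).aemeasurable
    · exact tsub_le_tsub_left (antitone_negExp (hmono x h)) 1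
    · exact ENNReal.Tendsto.sub tendsto_const_nhds ((continuous_negExp.tendsto _).comp (hlim x))
        (Or.inl (by simp))
  simp_rw [hfin] at hL
  exact tendsto_nhds_unique hL hR

/-- The Laplace functional of a homogeneous Poisson process with independent marks of law `ν`. -/
theorem lintegral_negExp_tsum_marked [IsProbabilityMeasure μ] (hX : IsHomogeneousPPP X d μ)
    {h : ℕ → Ω → ℝ} {ν : Measure ℝ} [IsProbabilityMeasure ν] (hh : ∀ n, Measurable (h n))
    (hlaw : ∀ n, HasLaw (h n) ν μ) (hind : iIndepFun h μ)
    (hXh : IndepFun (fun ω n => X n ω) (fun ω n => h n ω) μ)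
    {f : Plane → ℝ → ℝ≥0∞} (hf : Measurable (Function.uncurry f)) :
    ∫⁻ ω, negExp (∑' n, f (X n ω) (h n ω)) ∂μ =
      negExp (ENNReal.ofReal d * ∫⁻ x, 1 - ∫⁻ t, negExp (f x t) ∂ν) := by
  have hf' : Measurable fun p : Plane × ℝ => negExp (f p.1 p.2) := measurable_negExp.comp hf
  let g : Plane → ℝ≥0∞ := fun x => ∫⁻ t, negExp (f x t) ∂ν
  have hg : Measurable g := hf'.lintegral_prod_right'
  let G : Plane → ℝ≥0∞ := fun x => (-(ENNReal.log (g x))).toENNReal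
  have hG : Measurable G := (ENNReal.measurable_log.comp hg).neg.ereal_toENNReal
  have hGg : ∀ x, negExp (G x) = g x := fun x => exists_negExp_eq (lintegral_negExp_le_one ν _)
  have hXm : Measurable fun ω n => X n ω := measurable_pi_lambda _ hX.measurable
  have hhm : Measurable fun ω n => h n ω := measurable_pi_lambda _ hh
  have hfX : ∀ n, Measurable fun ω => f (X n ω) (h n ω) := fun n =>
    hf.comp ((hX.measurable n).prodMk (hh n))
  -- Independence yields product formulas for finitely many factors only, hence the truncation at
  -- `N`. Fubini freezes the locations, and each mark then integrates to `e^{-G}`.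
  have hN : ∀ N, ∫⁻ ω, ∏ n ∈ Finset.range N, negExp (f (X n ω) (h n ω)) ∂μ =
      ∫⁻ ω, ∏ n ∈ Finset.range N, negExp (G (X n ω)) ∂μ := by
    intro N
    have hΦ : Measurable fun p : (ℕ → Plane) × (ℕ → ℝ) =>
        ∏ n ∈ Finset.range N, negExp (f (p.1 n) (p.2 n)) := by
      refine Finset.measurable_prod _ fun n _ => ?_
      have : Measurable fun p : (ℕ → Plane) × (ℕ → ℝ) => (p.1 n, p.2 n) := by fun_prop
      exact hf'.comp this
    have h1 := (indepFun_iff_map_prod_eq_prod_map_map hXm.aemeasurable hhm.aemeasurable).1 hXh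
    have h2 := lintegral_map hΦ (hXm.prodMk hhm) (μ := μ)
    have : IsProbabilityMeasure (μ.map fun ω n => h n ω) :=
      Measure.isProbabilityMeasure_map hhm.aemeasurable
    rw [← h2, h1, lintegral_prod _ hΦ.aemeasurable, lintegral_map hΦ.lintegral_prod_right' hXm]
    refine lintegral_congr fun ω => ?_
    refine (lintegral_map (hΦ.comp measurable_prodMk_left) hhm).trans ?_
    have hm : ∀ n, Measurable fun t => negExp (f (X n ω) t) := fun n =>
      hf'.comp measurable_prodMk_left
    have := lintegral_prod_eq_prod_lintegral_of_indepFun (Finset.range N)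
      (fun n ω' => negExp (f (X n ω) (h n ω'))) (hind.comp _ hm) (fun n => (hm n).comp (hh n))
    refine this.trans (Finset.prod_congr rfl fun n _ => ?_)
    rw [hGg, ← lintegral_map (hm n) (hh n), (hlaw n).map_eq]
  have hL : Tendsto (fun N => ∫⁻ ω, ∏ n ∈ Finset.range N, negExp (f (X n ω) (h n ω)) ∂μ) atTop
      (𝓝 (∫⁻ ω, negExp (∑' n, f (X n ω) (h n ω)) ∂μ)) :=
    tendsto_lintegral_of_le_one μ
      (fun N => Finset.measurable_prod _ fun n _ => measurable_negExp.comp (hfX n))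
      (fun N ω => Finset.prod_le_one' fun n _ => negExp_le_one _)
      (fun ω => tendsto_prod_negExp _)
  have hR : Tendsto (fun N => ∫⁻ ω, ∏ n ∈ Finset.range N, negExp (G (X n ω)) ∂μ) atTop
      (𝓝 (∫⁻ ω, negExp (∑' n, G (X n ω)) ∂μ)) :=
    tendsto_lintegral_of_le_one μ
      (fun N => Finset.measurable_prod _ fun n _ =>
        measurable_negExp.comp (hG.comp (hX.measurable n)))
      (fun N ω => Finset.prod_le_one' fun n _ => negExp_le_one _)
      (fun ω => tendsto_prod_negExp _)
  simp_rw [hN] at hL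
  rw [tendsto_nhds_unique hL hR, hX.lintegral_negExp_tsum hG]
  simp_rw [hGg, g]

end IsHomogeneousPPP

/-- The Laplace transform of the Gamma distribution. -/
theorem lintegral_negExp_gammaMeasure {a r y : ℝ} (ha : 0 < a) (hr : 0 < r) (hy : 0 ≤ y) :
    ∫⁻ t, negExp (ENNReal.ofReal (y * t)) ∂(gammaMeasure a r) =
      ENNReal.ofReal ((1 + y / r) ^ (-a)) := by
  have hm : Measurable fun t : ℝ => negExp (ENNReal.ofReal (y * t)) := by fun_prop
  have hpdf : Measurable (gammaPDF a r) := (measurable_gammaPDFReal a r).ennreal_ofReal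
  have hpdf' : Measurable (gammaPDF a (r + y)) :=
    (measurable_gammaPDFReal a (r + y)).ennreal_ofReal
  rw [gammaMeasure, lintegral_withDensity_eq_lintegral_mul _ hpdf hm]
  -- Exponential tilting: `e^{-yt}` times the Gamma density of rate `r` is a multiple of the Gamma
  -- density of rate `r + y`.
  have key : ∀ t, (gammaPDF a r * fun t : ℝ => negExp (ENNReal.ofReal (y * t))) t =
      ENNReal.ofReal ((1 + y / r) ^ (-a)) * gammaPDF a (r + y) t := by
    intro t
    rw [Pi.mul_apply]
    rcases lt_or_ge t 0 with ht | ht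
    · rw [gammaPDF_of_neg ht, gammaPDF_of_neg ht]; simp
    · have h1 : 1 + y / r = (r + y) / r := by field_simp
      rw [gammaPDF_of_nonneg ht, gammaPDF_of_nonneg ht, negExp_ofReal (by positivity),
        ← ENNReal.ofReal_mul (by positivity), ← ENNReal.ofReal_mul (by positivity), h1,
        Real.div_rpow (by positivity) hr.le, Real.rpow_neg (by positivity), Real.rpow_neg hr.le,
        show -((r + y) * t) = -(r * t) + -(y * t) by ring, Real.exp_add]
      congr 1
      field_simp
  simp_rw [key]
  rw [lintegral_const_mul _ hpdf',
    lintegral_gammaPDF_eq_one ha (by positivity), mul_one]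

/-! ### An integral representation of the hypergeometric function -/

/-- `1 - zu` lies on the segment from `1` to `1 - z`, and the slit plane is star-shaped about `1`.
Hence the Euler integrand has no pole. -/
theorem one_sub_mul_mem_slitPlane {z : ℂ} (hz : z ∈ cutPlane) {u : ℝ} (hu : u ∈ Set.Icc (0 : ℝ) 1) :
    1 - z * u ∈ Complex.slitPlane := by
  have := Complex.starConvex_one_slitPlane (show 1 - z ∈ Complex.slitPlane from hz)
    (a := 1 - u) (b := u) (by linarith [hu.2]) hu.1 (by ring)
  convert this using 1
  simp only [Complex.real_smul, Complex.ofReal_sub, Complex.ofReal_one]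
  ring

theorem integrableOn_rpow_neg_Icc {δ : ℝ} (hδ : δ < 1) :
    IntegrableOn (fun u : ℝ => u ^ (-δ)) (Set.Icc 0 1) := by
  rw [integrableOn_Icc_iff_integrableOn_Ioc,
    ← intervalIntegrable_iff_integrableOn_Ioc_of_le zero_le_one]
  exact intervalIntegral.intervalIntegrable_rpow' (by linarith)

/-- The integral `∫₀¹ u^{-δ} (1 - z u)^{-k} du`. -/
noncomputable def eulerIntegral (δ : ℝ) (k : ℕ) (z : ℂ) : ℂ :=
  ∫ u in Set.Icc (0 : ℝ) 1, ((u ^ (-δ) : ℝ) : ℂ) * ((1 - z * u)⁻¹) ^ k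

theorem continuousOn_inv_one_sub_mul_pow (k : ℕ) :
    ContinuousOn (fun p : ℂ × ℝ => ((1 - p.1 * p.2)⁻¹) ^ k) (cutPlane ×ˢ Set.Icc (0 : ℝ) 1) := by
  refine ContinuousOn.pow (ContinuousOn.inv₀ (by fun_prop) fun p hp => ?_) k
  exact Complex.slitPlane_ne_zero (one_sub_mul_mem_slitPlane hp.1 hp.2)

theorem integrableOn_rpow_neg_mul {δ : ℝ} (hδ : δ < 1) {g : ℝ → ℂ}
    (hg : ContinuousOn g (Set.Icc 0 1)) :
    IntegrableOn (fun u : ℝ => ((u ^ (-δ) : ℝ) : ℂ) * g u) (Set.Icc 0 1) := by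
  have : IntegrableOn (fun u : ℝ => ((u ^ (-δ) : ℝ) : ℂ)) (Set.Icc 0 1) :=
    (integrableOn_rpow_neg_Icc hδ).ofReal
  exact this.mul_continuousOn hg isCompact_Icc

theorem integrableOn_eulerIntegral {δ : ℝ} (hδ : δ < 1) (k : ℕ) {z : ℂ} (hz : z ∈ cutPlane) :
    IntegrableOn (fun u : ℝ => ((u ^ (-δ) : ℝ) : ℂ) * ((1 - z * u)⁻¹) ^ k) (Set.Icc 0 1) :=
  integrableOn_rpow_neg_mul hδ ((continuousOn_inv_one_sub_mul_pow k).comp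
    (f := fun u : ℝ => (z, u)) (by fun_prop) fun _ hu => ⟨hz, hu⟩)

/-- Differentiation under the integral: the `z`-derivative of the kernel is bounded on a compact
ball times `[0, 1]`, and `u^{-δ}` is integrable. -/
theorem differentiableAt_eulerIntegral {δ : ℝ} (hδ : δ < 1) (k : ℕ) {z : ℂ} (hz : z ∈ cutPlane) :
    DifferentiableAt ℂ (eulerIntegral δ k) z := by
  obtain ⟨ε, hε, hball⟩ := Metric.nhds_basis_closedBall.mem_iff.1 (isOpen_cutPlane.mem_nhds hz)
  let D : ℂ × ℝ → ℂ := fun p => k * p.2 * ((1 - p.1 * p.2)⁻¹) ^ (k + 1)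
  have hD : ContinuousOn D (cutPlane ×ˢ Set.Icc (0 : ℝ) 1) :=
    ContinuousOn.mul (by fun_prop) (continuousOn_inv_one_sub_mul_pow (k + 1))
  obtain ⟨C, hC⟩ := ((isCompact_closedBall z ε).prod isCompact_Icc).exists_bound_of_continuousOn
    (hD.mono (Set.prod_mono hball Set.Subset.rfl))
  suffices h : HasDerivAt (fun z : ℂ => ∫ u in Set.Icc (0 : ℝ) 1,
      ((u ^ (-δ) : ℝ) : ℂ) * ((1 - z * u)⁻¹) ^ k)
      (∫ u in Set.Icc (0 : ℝ) 1, ((u ^ (-δ) : ℝ) : ℂ) * D (z, u)) z from h.differentiableAt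
  refine (hasDerivAt_integral_of_dominated_loc_of_deriv_le (μ := volume.restrict (Set.Icc (0 : ℝ) 1))
    (F := fun (z : ℂ) (u : ℝ) => ((u ^ (-δ) : ℝ) : ℂ) * ((1 - z * u)⁻¹) ^ k)
    (F' := fun (z : ℂ) (u : ℝ) => ((u ^ (-δ) : ℝ) : ℂ) * D (z, u))
    (bound := fun u => u ^ (-δ) * C) (Metric.closedBall_mem_nhds z hε) ?_
    (integrableOn_eulerIntegral hδ k hz) ?_ ?_ ((integrableOn_rpow_neg_Icc hδ).mul_const C)
    ?_).2
  · filter_upwards [isOpen_cutPlane.mem_nhds hz] with w hw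
    exact (integrableOn_eulerIntegral hδ k hw).aestronglyMeasurable
  · exact (integrableOn_rpow_neg_mul hδ (hD.comp (f := fun u : ℝ => (z, u)) (by fun_prop)
      fun _ hu => ⟨hz, hu⟩)).aestronglyMeasurable
  · filter_upwards [ae_restrict_mem measurableSet_Icc] with u hu w hw
    rw [norm_mul, Complex.norm_real, Real.norm_of_nonneg (Real.rpow_nonneg hu.1 _)]
    exact mul_le_mul_of_nonneg_left (hC (w, u) ⟨hw, hu⟩) (Real.rpow_nonneg hu.1 _)
  · filter_upwards [ae_restrict_mem measurableSet_Icc] with u hu w hw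
    have hne : 1 - w * u ≠ 0 :=
      Complex.slitPlane_ne_zero (one_sub_mul_mem_slitPlane (hball hw) hu)
    have h1 : HasDerivAt (fun w : ℂ => 1 - w * u) (-u) w := by
      simpa using ((hasDerivAt_id w).mul_const (u : ℂ)).const_sub 1
    refine HasDerivAt.const_mul _ ?_
    have h2 := (h1.fun_inv hne).fun_pow k
    refine h2.congr_deriv ?_
    -- The power rule produces the truncated exponent `k - 1`, so `k = 0` is treated apart.
    rcases k with _ | k
    · simp [D]
    · simp only [D, Nat.add_sub_cancel, neg_neg, div_eq_mul_inv, ← inv_pow]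
      ring

theorem integral_rpow_neg_mul_pow {δ : ℝ} (hδ : δ < 1) (n : ℕ) :
    ∫ u in Set.Icc (0 : ℝ) 1, u ^ (-δ) * u ^ n = 1 / (n + 1 - δ) := by
  have hn : (0 : ℝ) ≤ n := n.cast_nonneg
  rw [integral_Icc_eq_integral_Ioc]
  have : ∀ u ∈ Set.Ioc (0 : ℝ) 1, u ^ (-δ) * u ^ n = u ^ ((n : ℝ) - δ) := fun u hu => by
    rw [← Real.rpow_natCast, ← Real.rpow_add hu.1]; ring_nf
  rw [setIntegral_congr_fun measurableSet_Ioc this, ← intervalIntegral.integral_of_le zero_le_one,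
    integral_rpow (Or.inl (by linarith)), Real.one_rpow, Real.zero_rpow (by linarith)]
  ring_nf

/-- The negative binomial series of `(1 - zu)^{-(k+1)}`, integrated term by term. -/
theorem hasSum_eulerIntegral {δ : ℝ} (hδ : δ < 1) (k : ℕ) {z : ℂ} (hz : ‖z‖ < 1) :
    HasSum (fun n : ℕ => ((n + k).choose k : ℂ) * z ^ n * (1 / (n + 1 - δ)))
      (eulerIntegral δ (k + 1) z) := by
  let F : ℕ → ℝ → ℂ := fun n u => ((u ^ (-δ) * u ^ n : ℝ) : ℂ) * (((n + k).choose k : ℂ) * z ^ n)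
  have hint : ∀ n, IntegrableOn (fun u : ℝ => u ^ (-δ) * u ^ n) (Set.Icc 0 1) := fun n =>
    (integrableOn_rpow_neg_Icc hδ).mul_continuousOn (by fun_prop) isCompact_Icc
  have hs : Summable fun n : ℕ => ((n + k).choose k : ℝ) * ‖z‖ ^ n :=
    (hasSum_choose_mul_geometric_of_norm_lt_one k (r := ‖z‖) (by simpa using hz)).summable
  have hF : ∀ n, ∫ u in Set.Icc (0 : ℝ) 1, ‖F n u‖ =
      (1 / (n + 1 - δ)) * (((n + k).choose k : ℝ) * ‖z‖ ^ n) := by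
    intro n
    rw [← integral_rpow_neg_mul_pow hδ, ← integral_mul_const]
    refine setIntegral_congr_fun measurableSet_Icc fun u hu => ?_
    have : 0 ≤ u ^ (-δ) * u ^ n := mul_nonneg (Real.rpow_nonneg hu.1 _) (pow_nonneg hu.1 _)
    simp only [F]
    rw [norm_mul, Complex.norm_real, Real.norm_of_nonneg this, norm_mul, norm_pow,
      Complex.norm_natCast]
  have h := hasSum_integral_of_summable_integral_norm (μ := volume.restrict (Set.Icc (0 : ℝ) 1))
    (F := F) (fun n => ((hint n).ofReal (𝕜 := ℂ)).mul_const _) ?_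
  · convert! h using 1
    · ext n
      simp only [F]
      rw [integral_mul_const, integral_complex_ofReal, integral_rpow_neg_mul_pow hδ]
      push_cast
      ring
    · refine setIntegral_congr_fun measurableSet_Icc fun u hu => ?_
      have hzu : ‖z * u‖ < 1 := by
        rw [norm_mul, Complex.norm_real, Real.norm_of_nonneg hu.1]
        exact (mul_le_of_le_one_right (norm_nonneg z) hu.2).trans_lt hz
      have := (hasSum_choose_mul_geometric_of_norm_lt_one k hzu).mul_left ((u ^ (-δ) : ℝ) : ℂ)
      rw [one_div, ← inv_pow] at this
      rw [← this.tsum_eq]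
      refine tsum_congr fun n => ?_
      simp only [F]
      push_cast
      ring
  · simp_rw [hF]
    refine Summable.of_nonneg_of_le (fun n => ?_) (fun n => ?_) (hs.mul_left (1 / (1 - δ)))
    · have : (0 : ℝ) ≤ n := n.cast_nonneg
      have : 0 < n + 1 - δ := by linarith
      positivity
    · have : (0 : ℝ) ≤ n := n.cast_nonneg
      refine mul_le_mul_of_nonneg_right ?_ (by positivity)
      exact one_div_le_one_div_of_le (by linarith) (by linarith)

/-- The hockey-stick identity; it adds the `M` Euler series up to the coefficient `(M)ₙ₊₁ / (n+1)!`.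
-/
theorem sum_range_choose_add (n M : ℕ) :
    ∑ k ∈ Finset.range M, (n + k).choose k = (n + M).choose (n + 1) := by
  induction M with
  | zero => simp
  | succ M ih =>
    rw [Finset.sum_range_succ, ih, ← Nat.choose_symm_add, ← add_assoc, Nat.choose_succ_succ, add_comm]

/-- The Gauss hypergeometric function `₂F₁[-δ, M; 1 - δ; z]` as an integral. -/
noncomputable def hypergeometricIntegral (δ : ℝ) (M : ℕ) (z : ℂ) : ℂ :=
  1 - δ * z * ∑ k ∈ Finset.range M, eulerIntegral δ (k + 1) z

/-- Both symbols share the factor `(1-δ)ₙ`: one is `-δ (1-δ)ₙ`, the other `(1-δ)ₙ (1-δ+n)`. -/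
theorem ascPochhammer_eval_neg_div {δ : ℝ} (hδ : δ < 1) (n : ℕ) :
    (ascPochhammer ℂ (n + 1)).eval (-(δ : ℂ)) * ((ascPochhammer ℂ (n + 1)).eval (1 - (δ : ℂ)))⁻¹ =
      -δ * (1 / (n + 1 - δ)) := by
  have hne : ∀ m : ℕ, (1 : ℂ) - δ + m ≠ 0 := fun m => by
    have : (0 : ℝ) < 1 - δ + m := by
      have : (0 : ℝ) ≤ m := m.cast_nonneg
      linarith
    exact_mod_cast this.ne'
  have hne' : ∀ m, (ascPochhammer ℂ m).eval (1 - (δ : ℂ)) ≠ 0 := fun m => by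
    induction m with
    | zero => simp
    | succ m ih => rw [ascPochhammer_succ_eval]; exact mul_ne_zero ih (hne m)
  have h1 : (ascPochhammer ℂ (n + 1)).eval (-(δ : ℂ)) =
      -δ * (ascPochhammer ℂ n).eval (1 - (δ : ℂ)) := by
    rw [ascPochhammer_succ_left, Polynomial.eval_mul, Polynomial.eval_X, Polynomial.eval_comp]
    congr 2
    simp; ring
  rw [h1, ascPochhammer_succ_eval, show (n : ℂ) + 1 - δ = 1 - δ + n by ring]
  have := hne n
  have := hne' n
  field_simp

theorem ascPochhammer_eval_natCast_div (M n : ℕ) :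
    ((n + 1).factorial : ℂ)⁻¹ * (ascPochhammer ℂ (n + 1)).eval (M : ℂ) =
      ((n + M).choose (n + 1) : ℂ) := by
  rw [← ascPochhammer_eval_cast, ascPochhammer_nat_eq_ascFactorial,
    Nat.ascFactorial_eq_factorial_mul_choose']
  have : ((n + 1).factorial : ℂ) ≠ 0 := by exact_mod_cast (n + 1).factorial_ne_zero
  push_cast
  rw [inv_mul_cancel_left₀ this]
  congr 2
  omega

theorem isGaussHypergeometric_hypergeometricIntegral {δ : ℝ} (hδ : δ < 1) (M : ℕ) :
    IsGaussHypergeometric (-δ) M (1 - δ) (hypergeometricIntegral δ M) where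
  differentiableOn z hz := by
    unfold hypergeometricIntegral
    refine DifferentiableAt.differentiableWithinAt ?_
    have := fun k => differentiableAt_eulerIntegral hδ k hz
    fun_prop
  eq_series z hz := by
    have h1 := (hasSum_sum fun k (_ : k ∈ Finset.range M) =>
      hasSum_eulerIntegral hδ k hz).mul_left (-δ * z)
    have h2 : HasSum (fun n : ℕ => ordinaryHypergeometricCoefficient (-(δ : ℂ)) M (1 - δ) (n + 1) *
        z ^ (n + 1)) (-δ * z * ∑ k ∈ Finset.range M, eulerIntegral δ (k + 1) z) := by
      convert! h1 using 1
      ext n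
      rw [ordinaryHypergeometricCoefficient,
        mul_right_comm _ (Polynomial.eval _ _) (Polynomial.eval (M : ℂ) _),
        ascPochhammer_eval_natCast_div, mul_assoc ((n + M).choose (n + 1) : ℂ),
        ascPochhammer_eval_neg_div hδ,
        ← sum_range_choose_add, ← Finset.sum_mul, ← Finset.sum_mul]
      push_cast
      ring
    rw [ordinaryHypergeometric_eq_tsum, hypergeometricIntegral]
    -- The prefactor `z` shifts the index by one; the missing term `n = 0` is the leading `1`.
    have h3 := (hasSum_nat_add_iff (f := fun n : ℕ =>
      ordinaryHypergeometricCoefficient (-(δ : ℂ)) M (1 - δ) n * z ^ n) 1).1 h2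
    simp only [smul_eq_mul]
    rw [h3.tsum_eq]
    simp [ordinaryHypergeometricCoefficient, ascPochhammer_zero]
    ring

theorem gaussHypergeometric_eq_hypergeometricIntegral {δ : ℝ} (hδ : δ < 1) (M : ℕ) {z : ℂ}
    (hz : z ∈ cutPlane) :
    gaussHypergeometric (-δ) M (1 - δ) z = hypergeometricIntegral δ M z := by
  have h : ∃ F, IsGaussHypergeometric (-δ) M (1 - δ) F :=
    ⟨_, isGaussHypergeometric_hypergeometricIntegral hδ M⟩
  rw [gaussHypergeometric, dif_pos h]
  exact h.choose_spec.eqOn (isGaussHypergeometric_hypergeometricIntegral hδ M) hz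

/-! ### The intensity integral of the interference -/

/-- At `v = 1 + yu` the factor `v - 1 = yu` lowers the singularity `u^{-δ-1}` to the integrable
`u^{-δ}`. -/
theorem one_sub_inv_pow_eq_sum {v : ℝ} (hv : v ≠ 0) (M : ℕ) :
    1 - (v ^ M)⁻¹ = (v - 1) * ∑ k ∈ Finset.range M, v⁻¹ ^ (k + 1) := by
  have h := mul_neg_geom_sum v⁻¹ M
  simp_rw [pow_succ', ← Finset.mul_sum]
  rw [← inv_pow, ← h, ← mul_assoc]
  congr 1
  field_simp

theorem hypergeometricIntegral_neg_ofReal {δ : ℝ} (hδ : δ < 1) (M : ℕ) {y : ℝ} (hy : 0 ≤ y) :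
    hypergeometricIntegral δ M ((-y : ℝ) : ℂ) =
      ((1 + δ * ∫ u in Set.Ioc (0 : ℝ) 1, u ^ (-δ - 1) * (1 - ((1 + y * u) ^ M)⁻¹) : ℝ) : ℂ) := by
  have hz : ((-y : ℝ) : ℂ) ∈ cutPlane := by
    refine Or.inl ?_
    simp only [Complex.sub_re, Complex.one_re, Complex.ofReal_re]
    linarith
  simp only [hypergeometricIntegral, eulerIntegral]
  rw [← integral_finsetSum _ fun k _ => integrableOn_eulerIntegral hδ (k + 1) hz, mul_assoc,
    ← integral_const_mul, integral_Icc_eq_integral_Ioc, Complex.ofReal_add, Complex.ofReal_mul,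
    Complex.ofReal_one, ← integral_complex_ofReal, sub_eq_add_neg, ← mul_neg, ← integral_neg]
  congr 2
  refine setIntegral_congr_fun measurableSet_Ioc fun u hu => ?_
  have hv : 1 + y * u ≠ 0 := by have := mul_nonneg hy hu.1.le; positivity
  have h1 : u ^ (-δ) = u ^ (-δ - 1) * u := by
    rw [← Real.rpow_add_one hu.1.ne']; ring_nf
  rw [one_sub_inv_pow_eq_sum hv, h1, ← Finset.mul_sum]
  push_cast
  rw [show (1 : ℂ) - -(y : ℂ) * u = 1 + y * u by ring]
  ring

theorem integral_norm_ge_radial {α c ρ : ℝ} (hα : 0 < α) (hρ : 0 < ρ) (M : ℕ) :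
    ∫ x in {x : Plane | ρ ≤ ‖x‖}, (1 - ((1 + c * ‖x‖ ^ (-α)) ^ M)⁻¹) =
      Real.pi * ρ ^ 2 * (2 / α * ∫ u in Set.Ioc (0 : ℝ) 1,
        u ^ (-(2 / α) - 1) * (1 - ((1 + c * ρ ^ (-α) * u) ^ M)⁻¹)) := by
  let f : ℝ → ℝ := (Set.Ici ρ).indicator fun t => 1 - ((1 + c * t ^ (-α)) ^ M)⁻¹
  let g : ℝ → ℝ := fun t => t ^ 1 • f t
  have hS : MeasurableSet {x : Plane | ρ ≤ ‖x‖} := measurableSet_le measurable_const measurable_norm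
  have h1 := integral_fun_norm_addHaar (volume : Measure Plane) f
  have h2 := integral_comp_mul_left_Ioi g 0 hρ
  -- The substitution `t = ρ u^{-1/α}` maps `t ≥ ρ` to `0 < u ≤ 1` and makes `t^{-α}` linear in `u`.
  have h3 := integral_comp_rpow_Ioi (fun x => g (ρ * x)) (p := -(1 / α)) (by simp [hα.ne'])
  have h4 : ∀ u ∈ Set.Ioi (0 : ℝ), (|-(1 / α)| * u ^ (-(1 / α) - 1)) • g (ρ * u ^ (-(1 / α))) =
      (Set.Ioc (0 : ℝ) 1).indicator (fun u => ρ / α *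
        (u ^ (-(2 / α) - 1) * (1 - ((1 + c * ρ ^ (-α) * u) ^ M)⁻¹))) u := by
    intro u hu
    have hu : 0 < u := hu
    have hiff : ρ ≤ ρ * u ^ (-(1 / α)) ↔ u ≤ 1 := by
      rw [le_mul_iff_one_le_right hρ]
      constructor
      · intro h
        by_contra! h'
        exact absurd h (not_le.2 (Real.rpow_lt_one_of_one_lt_of_neg h' (by simp [hα])))
      · intro h
        exact Real.one_le_rpow_of_pos_of_le_one_of_nonpos hu h (by simp [hα.le])
    by_cases h : u ≤ 1
    · rw [Set.indicator_of_mem (show u ∈ Set.Ioc (0 : ℝ) 1 from ⟨hu, h⟩)]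
      simp only [g, f]
      rw [Set.indicator_of_mem (show _ ∈ Set.Ici ρ from hiff.2 h),
        Real.mul_rpow hρ.le (Real.rpow_nonneg hu.le _), ← Real.rpow_mul hu.le, abs_neg,
        abs_of_pos (one_div_pos.2 hα), show -(1 / α) * -α = 1 by field_simp, Real.rpow_one,
        show -(2 / α) - 1 = (-(1 / α) - 1) + -(1 / α) by ring, Real.rpow_add hu]
      simp only [smul_eq_mul]
      ring
    · rw [Set.indicator_of_notMem fun h' => h h'.2]
      simp only [g, f]
      rw [Set.indicator_of_notMem (show ¬ _ ∈ Set.Ici ρ from fun h' => h (hiff.1 h'))]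
      simp
  rw [setIntegral_congr_fun measurableSet_Ioi h4, setIntegral_indicator measurableSet_Ioc,
    Set.inter_eq_right.2 Set.Ioc_subset_Ioi_self, integral_const_mul] at h3
  rw [← h3, mul_zero, eq_comm, smul_eq_mul, inv_mul_eq_iff_eq_mul₀ hρ.ne'] at h2
  rw [← integral_indicator hS]
  have h5 : ∀ x : Plane, {x : Plane | ρ ≤ ‖x‖}.indicator
      (fun x => 1 - ((1 + c * ‖x‖ ^ (-α)) ^ M)⁻¹) x = f ‖x‖ := fun x => rfl
  have h6 : (volume : Measure Plane).real (Metric.ball 0 1) = Real.pi := by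
    rw [Measure.real, EuclideanSpace.volume_ball_fin_two]
    simp [Real.pi_pos.le]
  simp_rw [h5]
  rw [h1, h6, finrank_euclideanSpace_fin, h2]
  simp only [smul_eq_mul, nsmul_eq_mul]
  push_cast
  ring

theorem integrableOn_norm_ge_rpow_neg {α ρ : ℝ} (hα : 2 < α) (hρ : 0 < ρ) :
    IntegrableOn (fun x : Plane => ‖x‖ ^ (-α)) {x : Plane | ρ ≤ ‖x‖} := by
  have hS : MeasurableSet {x : Plane | ρ ≤ ‖x‖} := measurableSet_le measurable_const measurable_norm
  rw [← integrable_indicator_iff hS]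
  have h := integrable_fun_norm_addHaar (volume : Measure Plane)
    (f := (Set.Ici ρ).indicator fun t => t ^ (-α))
  refine h.2 ?_
  have h1 : IntegrableOn (fun t : ℝ => t ^ (1 - α)) (Set.Ici ρ) :=
    (integrableOn_Ici_iff_integrableOn_Ioi).2 (integrableOn_Ioi_rpow_of_lt (by linarith) hρ)
  refine ((integrable_indicator_iff measurableSet_Ici).2 h1).integrableOn.congr_fun
    (fun t ht => ?_) measurableSet_Ioi
  have ht : 0 < t := ht
  rw [finrank_euclideanSpace_fin]
  by_cases h : t ∈ Set.Ici ρ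
  · simp only [Set.indicator_of_mem h, smul_eq_mul]
    rw [sub_eq_add_neg, Real.rpow_add ht]
    simp
  · simp [Set.indicator_of_notMem h]

/-- This linear bound gives integrability at infinity when `α > 2`, and the vanishing of the
exponent as `s → 0`. -/
theorem one_sub_inv_one_add_pow_le {x : ℝ} (hx : 0 ≤ x) (M : ℕ) :
    1 - ((1 + x) ^ M)⁻¹ ≤ M * x := by
  have h1 : (1 + x) ^ M ≤ Real.exp (M * x) := by
    rw [Real.exp_nat_mul]
    exact pow_le_pow_left₀ (by positivity) (by linarith [Real.add_one_le_exp x]) M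
  have h2 : Real.exp (-(M * x)) ≤ ((1 + x) ^ M)⁻¹ := by
    rw [Real.exp_neg]
    exact inv_anti₀ (by positivity) h1
  linarith [Real.add_one_le_exp (-(M * x))]

theorem one_sub_inv_one_add_pow_nonneg {x : ℝ} (hx : 0 ≤ x) (M : ℕ) :
    0 ≤ 1 - ((1 + x) ^ M)⁻¹ :=
  sub_nonneg.2 (inv_le_one_of_one_le₀ (one_le_pow₀ (by linarith)))

theorem lintegral_norm_ge_radial_le {α c ρ : ℝ} (hα : 2 < α) (hc : 0 ≤ c) (hρ : 0 < ρ) (M : ℕ) :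
    ∫⁻ x in {x : Plane | ρ ≤ ‖x‖}, ENNReal.ofReal (1 - ((1 + c * ‖x‖ ^ (-α)) ^ M)⁻¹) ≤
      ENNReal.ofReal (c * (M * ∫ x in {x : Plane | ρ ≤ ‖x‖}, ‖x‖ ^ (-α))) := by
  rw [← mul_assoc, ← integral_const_mul, ofReal_integral_eq_lintegral_ofReal
    ((integrableOn_norm_ge_rpow_neg hα hρ).const_mul _) (ae_of_all _ fun x => by positivity)]
  refine lintegral_mono fun x => ENNReal.ofReal_le_ofReal ?_
  exact (one_sub_inv_one_add_pow_le (by positivity) M).trans_eq (by ring)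

theorem lintegral_norm_ge_radial {α c ρ : ℝ} (hα : 2 < α) (hc : 0 ≤ c) (hρ : 0 < ρ) (M : ℕ) :
    ∫⁻ x in {x : Plane | ρ ≤ ‖x‖}, ENNReal.ofReal (1 - ((1 + c * ‖x‖ ^ (-α)) ^ M)⁻¹) =
      ENNReal.ofReal (∫ x in {x : Plane | ρ ≤ ‖x‖}, (1 - ((1 + c * ‖x‖ ^ (-α)) ^ M)⁻¹)) := by
  refine (ofReal_integral_eq_lintegral_ofReal ?_
    (ae_of_all _ fun x => one_sub_inv_one_add_pow_nonneg (by positivity) M)).symm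
  refine ((integrableOn_norm_ge_rpow_neg hα hρ).const_mul (M * c)).mono'
    (Measurable.aestronglyMeasurable (by fun_prop)) (ae_of_all _ fun x => ?_)
  rw [Real.norm_of_nonneg (one_sub_inv_one_add_pow_nonneg (by positivity) M)]
  exact (one_sub_inv_one_add_pow_le (by positivity) M).trans_eq (by ring)

/-- The intensity integral in terms of the hypergeometric function. -/
theorem ofReal_integral_norm_ge_radial {α c ρ : ℝ} (hα : 2 < α) (hc : 0 ≤ c) (hρ : 0 < ρ) (M : ℕ) :
    ((∫ x in {x : Plane | ρ ≤ ‖x‖}, (1 - ((1 + c * ‖x‖ ^ (-α)) ^ M)⁻¹) : ℝ) : ℂ) =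
      ((Real.pi * ρ ^ 2 : ℝ) : ℂ) *
        (gaussHypergeometric ((-(2 / α) : ℝ) : ℂ) M ((1 - 2 / α : ℝ) : ℂ)
          ((-(c * ρ ^ (-α)) : ℝ) : ℂ) - 1) := by
  have hδ : 2 / α < 1 := (div_lt_one (by linarith)).2 hα
  have hy : 0 ≤ c * ρ ^ (-α) := by positivity
  have hz : ((-(c * ρ ^ (-α)) : ℝ) : ℂ) ∈ cutPlane := by
    refine Or.inl ?_
    simp only [Complex.sub_re, Complex.one_re, Complex.ofReal_re]
    linarith
  have h := gaussHypergeometric_eq_hypergeometricIntegral hδ M hz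
  rw [← Complex.ofReal_neg, ← Complex.ofReal_one, ← Complex.ofReal_sub] at h
  rw [h, hypergeometricIntegral_neg_ofReal hδ M hy, integral_norm_ge_radial (by linarith) hρ]
  push_cast
  ring

/-! ### The association event -/

/-- The points of the plane at which a station of tier `i` would be received with larger average
power than the serving station. -/
def strongerRegion (P α : Fin 2 → ℝ) (k : Fin 2) (r : ℝ) (i : Fin 2) : Set Plane :=
  {x | ¬ P i * ‖x‖ ^ (-α i) ≤ P k * r ^ (-α k)}

/-- The distance below which a station of tier `i` is received with larger average power than the
serving station. -/
noncomputable def exclusionRadius (P α : Fin 2 → ℝ) (k : Fin 2) (r : ℝ) (i : Fin 2) : ℝ :=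
  (P i / P k) ^ (1 / α i) * r ^ (1 / (α i / α k))

section Geometry

variable {P α : Fin 2 → ℝ} {k : Fin 2} {r : ℝ}

theorem measurableSet_strongerRegion (i : Fin 2) : MeasurableSet (strongerRegion P α k r i) :=
  (measurableSet_le (f := fun x : Plane => P i * ‖x‖ ^ (-α i)) (g := fun _ => P k * r ^ (-α k))
    (by fun_prop) measurable_const).compl

theorem exclusionRadius_pos (hP : ∀ i, 0 < P i) (hr : 0 < r) (i : Fin 2) :
    0 < exclusionRadius P α k r i := by
  have := hP i
  have := hP k
  unfold exclusionRadius
  positivity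

theorem exclusionRadius_rpow (hP : ∀ i, 0 < P i) (hr : 0 < r) (i : Fin 2)
    (b : ℝ) : exclusionRadius P α k r i ^ b = (P i / P k) ^ (b / α i) * r ^ (b / (α i / α k)) := by
  have := hP i
  have := hP k
  rw [exclusionRadius, Real.mul_rpow (by positivity) (by positivity), ← Real.rpow_mul (by positivity),
    ← Real.rpow_mul hr.le, one_div_mul_eq_div, one_div_mul_eq_div]

theorem exclusionRadius_le_norm_iff (hP : ∀ i, 0 < P i) (hα : ∀ i, 0 < α i) (hr : 0 < r)
    (i : Fin 2) {x : Plane} (hx : x ≠ 0) :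
    exclusionRadius P α k r i ≤ ‖x‖ ↔ x ∉ strongerRegion P α k r i := by
  have hx' : 0 < ‖x‖ := norm_pos_iff.2 hx
  have hPi := hP i
  have hPk := hP k
  have hi := hα i
  have h1 : P k * r ^ (-α k) = P i * exclusionRadius P α k r i ^ (-α i) := by
    rw [exclusionRadius_rpow hP hr, neg_div, div_self hi.ne', Real.rpow_neg_one,
      show -α i / (α i / α k) = -α k by have := (hα k).ne'; field_simp]
    field_simp
  rw [strongerRegion, Set.mem_ofPred_eq, not_not, h1, mul_le_mul_iff_right₀ hPi,
    Real.rpow_le_rpow_iff_of_neg hx' (exclusionRadius_pos hP hr i) (by linarith)]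

/-- An artefact of `0 ^ (-α) = 0` for real powers: the origin counts as received with power `0`. It
is a null set, so nothing else is affected. -/
theorem notMem_strongerRegion_zero (hP : ∀ i, 0 < P i) (hα : ∀ i, 0 < α i) (hr : 0 < r)
    (i : Fin 2) : (0 : Plane) ∉ strongerRegion P α k r i := by
  have := hP k
  rw [strongerRegion, Set.mem_ofPred_eq, not_not, norm_zero,
    Real.zero_rpow (neg_ne_zero.2 (hα i).ne'), mul_zero]
  positivity

theorem volume_strongerRegion_ne_top (hP : ∀ i, 0 < P i) (hα : ∀ i, 0 < α i) (hr : 0 < r)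
    (i : Fin 2) : volume (strongerRegion P α k r i) ≠ ∞ := by
  refine measure_ne_top_of_subset (s := Metric.ball 0 (exclusionRadius P α k r i)) (fun x hx => ?_)
    (measure_ball_lt_top (μ := volume) (x := (0 : Plane))).ne
  rcases eq_or_ne x 0 with rfl | h0
  · exact absurd hx (notMem_strongerRegion_zero hP hα hr i)
  · rw [mem_ball_zero_iff]
    by_contra! h
    exact (exclusionRadius_le_norm_iff hP hα hr i h0).1 h hx

theorem compl_strongerRegion_ae_eq (hP : ∀ i, 0 < P i) (hα : ∀ i, 0 < α i) (hr : 0 < r)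
    (i : Fin 2) : ((strongerRegion P α k r i)ᶜ : Set Plane) =ᵐ[volume]
      {x : Plane | exclusionRadius P α k r i ≤ ‖x‖} := by
  filter_upwards [Measure.ae_ne volume (0 : Plane)] with x hx
  exact propext (exclusionRadius_le_norm_iff hP hα hr i hx).symm

theorem forall_fin_two_iff_add_one (p : Fin 2 → Prop) (j : Fin 2) :
    (∀ i, p i) ↔ p j ∧ p (j + 1) := by
  fin_cases j <;> simp [Fin.forall_fin_two, and_comm]

theorem associationEvent_eq_inter {Ω : Type*} {X : Fin 2 → ℕ → Ω → Plane} (j : Fin 2) :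
    associationEvent P α X k r = {ω | ∀ n, X j n ω ∉ strongerRegion P α k r j} ∩
      {ω | ∀ n, X (j + 1) n ω ∉ strongerRegion P α k r (j + 1)} := by
  ext ω
  have h1 : ω ∈ associationEvent P α X k r ↔ ∀ i, ∀ n, X i n ω ∉ strongerRegion P α k r i := by
    simp [associationEvent, strongerRegion]
  rw [h1, forall_fin_two_iff_add_one _ j]
  rfl

end Geometry

/-! ### Void probabilities -/

section Void

variable {Ω : Type*} [MeasurableSpace Ω] {μ : Measure Ω} [IsProbabilityMeasure μ]
  {X : ℕ → Ω → Plane} {d : ℝ}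

theorem negExp_tsum_eq_zero {f : ℕ → ℝ≥0∞} {n : ℕ} (h : f n = ∞) : negExp (∑' n, f n) = 0 := by
  rw [ENNReal.tsum_eq_top_of_eq_top ⟨n, h⟩, negExp_top]

/-- Infinite cost on `B` encodes the event that `B` is empty. -/
theorem negExp_tsum_indicator_top (B : Set Plane) (x : ℕ → Plane) :
    negExp (∑' n, B.indicator (fun _ => ∞) (x n)) =
      {x : ℕ → Plane | ∀ n, x n ∉ B}.indicator 1 x := by
  by_cases h : ∀ n, x n ∉ B
  · rw [Set.indicator_of_mem (show x ∈ {x : ℕ → Plane | ∀ n, x n ∉ B} from h)]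
    simp [Set.indicator_of_notMem (h _)]
  · rw [Set.indicator_of_notMem (show ¬ x ∈ {x : ℕ → Plane | ∀ n, x n ∉ B} from h)]
    obtain ⟨n, hn⟩ := _root_.not_forall_not.1 h
    exact negExp_tsum_eq_zero (n := n) (Set.indicator_of_mem hn _)

theorem measurableSet_forall_notMem {B : Set Plane} (hB : MeasurableSet B) :
    MeasurableSet {x : ℕ → Plane | ∀ n, x n ∉ B} := by
  simp_rw [Set.ofPred_forall]
  exact MeasurableSet.iInter fun n => (measurable_pi_apply n hB).compl

/-- The void probabilities of a homogeneous Poisson process. -/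
theorem IsHomogeneousPPP.measure_forall_notMem (hX : IsHomogeneousPPP X d μ) {B : Set Plane}
    (hB : MeasurableSet B) :
    μ {ω | ∀ n, X n ω ∉ B} = negExp (ENNReal.ofReal d * volume B) := by
  have h := hX.lintegral_negExp_tsum (measurable_const.indicator hB : Measurable
    (B.indicator fun _ => ∞))
  have h1 : ∀ x, 1 - negExp (B.indicator (fun _ => ∞) x) = B.indicator 1 x := fun x => by
    by_cases hx : x ∈ B <;> simp [hx]
  have h2 : ∀ ω, negExp (∑' n, B.indicator (fun _ => ∞) (X n ω)) =
      {ω | ∀ n, X n ω ∉ B}.indicator 1 ω := fun ω =>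
    negExp_tsum_indicator_top B fun n => X n ω
  have hm : MeasurableSet {ω | ∀ n, X n ω ∉ B} :=
    measurable_pi_lambda (fun ω n => X n ω) hX.measurable (measurableSet_forall_notMem hB)
  simp_rw [h1, h2] at h
  rwa [lintegral_indicator_one hm, lintegral_indicator_one hB] at h

end Void

theorem ae_nonneg_gammaMeasure (a r : ℝ) : ∀ᵐ t ∂(gammaMeasure a r), 0 ≤ t := by
  rw [ae_iff]
  have : {t : ℝ | ¬ 0 ≤ t} = Set.Iio 0 := by ext; simp
  rw [this, gammaMeasure, withDensity_apply _ measurableSet_Iio, lintegral_gammaPDF_of_nonpos le_rfl]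

/-! ### The interference -/

namespace IsTwoTierNetwork

variable {Ω : Type*} [MeasurableSpace Ω] {μ : Measure Ω}
  {X : Fin 2 → ℕ → Ω → Plane} {h : Fin 2 → ℕ → Ω → ℝ} {d : Fin 2 → ℝ} {M : Fin 2 → ℕ}
  {P α : Fin 2 → ℝ} {k : Fin 2} {r : ℝ}

theorem measurableSet_associationEvent (hnet : IsTwoTierNetwork X h d M μ) :
    MeasurableSet (associationEvent P α X k r) := by
  simp_rw [associationEvent, Set.ofPred_forall]
  refine MeasurableSet.iInter fun i => MeasurableSet.iInter fun n => ?_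
  have := (hnet.ppp i).measurable n
  exact measurableSet_le (by fun_prop) measurable_const

/-- The forbidden region contributes its full area, which becomes the void probability; its
complement contributes the Gamma transform. -/
theorem lintegral_negExp_marks (hM : ∀ i, 1 ≤ M i) (hP : ∀ i, 0 < P i) (j : Fin 2) {s : ℝ}
    (hs : 0 ≤ s) (x : Plane) [DecidablePred (· ∈ strongerRegion P α k r j)] :
    1 - ∫⁻ t, negExp (if x ∈ strongerRegion P α k r j then ∞ else
        ENNReal.ofReal (s * (P j * t * ‖x‖ ^ (-α j)))) ∂(gammaMeasure (M j) (M j)) =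
      (strongerRegion P α k r j).indicator 1 x + (strongerRegion P α k r j)ᶜ.indicator
        (fun x => ENNReal.ofReal (1 - ((1 + s * P j / M j * ‖x‖ ^ (-α j)) ^ M j)⁻¹)) x := by
  have hMj : (0 : ℝ) < M j := by exact_mod_cast hM j
  have hPj := hP j
  by_cases hx : x ∈ strongerRegion P α k r j
  · simp [hx]
  · have h1 : ∀ t, s * (P j * t * ‖x‖ ^ (-α j)) = s * P j * ‖x‖ ^ (-α j) * t := fun t => by ring
    simp only [hx, if_false, h1, Set.mem_compl_iff, not_false_eq_true, Set.indicator_of_mem,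
      Set.indicator_of_notMem, zero_add]
    rw [lintegral_negExp_gammaMeasure hMj hMj (by positivity), Real.rpow_neg (by positivity),
      Real.rpow_natCast, ← ENNReal.ofReal_one, ← ENNReal.ofReal_sub _ (by positivity)]
    congr 5
    ring

theorem measurable_negExp_tsum_uncurry {f : Plane → ℝ → ℝ≥0∞}
    (hf : Measurable (Function.uncurry f)) :
    Measurable fun p : (ℕ → Plane) × (ℕ → ℝ) => negExp (∑' n, f (p.1 n) (p.2 n)) := by
  refine measurable_negExp.comp (Measurable.tsum fun n => ?_)
  have : Measurable fun p : (ℕ → Plane) × (ℕ → ℝ) => (p.1 n, p.2 n) := by fun_prop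
  exact hf.comp this

theorem measurableSet_forall_notMem_strongerRegion (hnet : IsTwoTierNetwork X h d M μ)
    (i : Fin 2) : MeasurableSet {ω | ∀ n, X i n ω ∉ strongerRegion P α k r i} :=
  measurable_pi_lambda (fun ω n => X i n ω) (hnet.ppp i).measurable
    (measurableSet_forall_notMem (measurableSet_strongerRegion i))

/-- The two tiers are independent: integration over the association event. -/
theorem setLIntegral_associationEvent (hnet : IsTwoTierNetwork X h d M μ) (j : Fin 2)
    {g : (ℕ → Plane) × (ℕ → ℝ) → ℝ≥0∞} (hg : Measurable g) :
    ∫⁻ ω in associationEvent P α X k r, g (fun n => X j n ω, fun n => h j n ω) ∂μ =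
      (∫⁻ ω in {ω | ∀ n, X j n ω ∉ strongerRegion P α k r j},
        g (fun n => X j n ω, fun n => h j n ω) ∂μ) *
      μ {ω | ∀ n, X (j + 1) n ω ∉ strongerRegion P α k r (j + 1)} := by
  have hVm := hnet.measurableSet_forall_notMem_strongerRegion (P := P) (α := α) (k := k) (r := r)
  have hS : ∀ i, MeasurableSet {p : (ℕ → Plane) × (ℕ → ℝ) |
      ∀ n, p.1 n ∉ strongerRegion P α k r i} := fun i =>
    measurable_fst (measurableSet_forall_notMem (measurableSet_strongerRegion i))
  have hpair : ∀ i, Measurable fun ω => ((fun n => X i n ω, fun n => h i n ω) :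
      (ℕ → Plane) × (ℕ → ℝ)) := fun i =>
    (measurable_pi_lambda _ (hnet.ppp i).measurable).prodMk
      (measurable_pi_lambda _ (hnet.measurable_fading i))
  -- In `Fin 2`, `j + 1` is the other tier.
  have hne : j ≠ j + 1 := by fin_cases j <;> simp
  have hg' := hg.indicator (hS j)
  have h1' : Measurable ({p : (ℕ → Plane) × (ℕ → ℝ) |
      ∀ n, p.1 n ∉ strongerRegion P α k r (j + 1)}.indicator fun _ => (1 : ℝ≥0∞)) :=
    measurable_const.indicator (hS (j + 1))
  have := lintegral_mul_eq_lintegral_mul_lintegral_of_indepFun''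
    (hg'.comp (hpair j)).aemeasurable (h1'.comp (hpair (j + 1))).aemeasurable
    ((hnet.tier_indep.indepFun hne).comp hg' h1')
  rw [← lintegral_indicator (hVm j), ← lintegral_indicator_one (hVm (j + 1)),
    ← lintegral_indicator hnet.measurableSet_associationEvent, associationEvent_eq_inter j]
  refine Eq.trans (lintegral_congr fun ω => ?_) this
  by_cases hj : ∀ n, X j n ω ∉ strongerRegion P α k r j <;>
    by_cases ho : ∀ n, X (j + 1) n ω ∉ strongerRegion P α k r (j + 1) <;>
    simp [Set.indicator, hj, ho]

theorem measure_associationEvent (hnet : IsTwoTierNetwork X h d M μ) (j : Fin 2) :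
    μ (associationEvent P α X k r) = μ {ω | ∀ n, X j n ω ∉ strongerRegion P α k r j} *
      μ {ω | ∀ n, X (j + 1) n ω ∉ strongerRegion P α k r (j + 1)} := by
  simpa using hnet.setLIntegral_associationEvent j (P := P) (α := α) (k := k) (r := r)
    (measurable_const (a := (1 : ℝ≥0∞)))

theorem measure_associationEvent_ne_zero [IsProbabilityMeasure μ]
    (hnet : IsTwoTierNetwork X h d M μ) (hP : ∀ i, 0 < P i) (hα : ∀ i, 0 < α i) (hr : 0 < r) :
    μ (associationEvent P α X k r) ≠ 0 := by
  rw [hnet.measure_associationEvent 0,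
    (hnet.ppp _).measure_forall_notMem (measurableSet_strongerRegion _),
    (hnet.ppp _).measure_forall_notMem (measurableSet_strongerRegion _)]
  exact mul_ne_zero
    (negExp_ne_zero (ENNReal.mul_ne_top (by simp) (volume_strongerRegion_ne_top hP hα hr _)))
    (negExp_ne_zero (ENNReal.mul_ne_top (by simp) (volume_strongerRegion_ne_top hP hα hr _)))

open Classical in
/-- The Laplace transform of the interference on the association event. -/
theorem setLIntegral_negExp [IsProbabilityMeasure μ] (hnet : IsTwoTierNetwork X h d M μ)
    (hM : ∀ i, 1 ≤ M i) (hP : ∀ i, 0 < P i) (hα : ∀ i, 0 < α i) (hr : 0 < r) (j : Fin 2) {s : ℝ}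
    (hs : 0 ≤ s) :
    ∫⁻ ω in associationEvent P α X k r,
        negExp (∑' n, ENNReal.ofReal (s * (P j * h j n ω * ‖X j n ω‖ ^ (-α j)))) ∂μ =
      μ (associationEvent P α X k r) * negExp (ENNReal.ofReal (d j) *
        ∫⁻ x in {x : Plane | exclusionRadius P α k r j ≤ ‖x‖},
          ENNReal.ofReal (1 - ((1 + s * P j / M j * ‖x‖ ^ (-α j)) ^ M j)⁻¹)) := by
  have hMj : (0 : ℝ) < M j := by exact_mod_cast hM j
  have := isProbabilityMeasure_gammaMeasure hMj hMj
  have hDm := measurableSet_strongerRegion (P := P) (α := α) (k := k) (r := r) j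
  have hg : Measurable (Function.uncurry fun (x : Plane) (t : ℝ) =>
      ENNReal.ofReal (s * (P j * t * ‖x‖ ^ (-α j)))) := by
    unfold Function.uncurry; fun_prop
  have hf : Measurable (Function.uncurry fun (x : Plane) (t : ℝ) =>
      if x ∈ strongerRegion P α k r j then ∞ else
        ENNReal.ofReal (s * (P j * t * ‖x‖ ^ (-α j)))) :=
    Measurable.ite (measurable_fst hDm) measurable_const hg
  have h1 := (hnet.ppp j).lintegral_negExp_tsum_marked (hnet.measurable_fading j)
      (hnet.fading_law j) (hnet.fading_indep j) (hnet.location_fading_indep j) hf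
  rw [lintegral_congr fun x => lintegral_negExp_marks hM hP j hs x,
    lintegral_add_left (measurable_one.indicator hDm), lintegral_indicator_one hDm,
    lintegral_indicator hDm.compl, mul_add, negExp_add, ← (hnet.ppp j).measure_forall_notMem hDm,
    setLIntegral_congr (compl_strongerRegion_ae_eq hP hα hr j)] at h1
  refine (hnet.setLIntegral_associationEvent j (measurable_negExp_tsum_uncurry hg)).trans ?_
  rw [hnet.measure_associationEvent j, mul_right_comm, ← h1,
    ← lintegral_indicator (hnet.measurableSet_forall_notMem_strongerRegion j)]
  congr 1
  refine lintegral_congr fun ω => ?_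
  by_cases hω : ∀ n, X j n ω ∉ strongerRegion P α k r j
  · rw [Set.indicator_of_mem (by exact hω)]
    simp only [hω, if_false]
  · rw [Set.indicator_of_notMem (by exact hω)]
    obtain ⟨n, hn⟩ := _root_.not_forall_not.1 hω
    exact (negExp_tsum_eq_zero (n := n) (if_pos hn)).symm

/-- The conditional Laplace transform of the interference. -/
theorem lintegral_cond_negExp [IsProbabilityMeasure μ] (hnet : IsTwoTierNetwork X h d M μ)
    (hM : ∀ i, 1 ≤ M i) (hP : ∀ i, 0 < P i) (hα : ∀ i, 0 < α i) (hr : 0 < r) (j : Fin 2) {s : ℝ}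
    (hs : 0 ≤ s) :
    ∫⁻ ω, negExp (ENNReal.ofReal s * ∑' n, ENNReal.ofReal (P j * h j n ω * ‖X j n ω‖ ^ (-α j)))
        ∂μ[|associationEvent P α X k r] =
      negExp (ENNReal.ofReal (d j) *
        ∫⁻ x in {x : Plane | exclusionRadius P α k r j ≤ ‖x‖},
          ENNReal.ofReal (1 - ((1 + s * P j / M j * ‖x‖ ^ (-α j)) ^ M j)⁻¹)) := by
  simp_rw [← ENNReal.tsum_mul_left, ← ENNReal.ofReal_mul hs]
  rw [ProbabilityTheory.cond, lintegral_smul_measure, hnet.setLIntegral_negExp hM hP hα hr j hs,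
    smul_eq_mul,
    ← mul_assoc, ENNReal.inv_mul_cancel (hnet.measure_associationEvent_ne_zero hP hα hr)
      (measure_ne_top _ _), one_mul]

/-- Almost surely, all stations are outside the exclusion radius. -/
theorem ae_exclusionRadius_le [IsProbabilityMeasure μ] (hnet : IsTwoTierNetwork X h d M μ)
    (hP : ∀ i, 0 < P i) (hα : ∀ i, 0 < α i) (hr : 0 < r) (j : Fin 2) :
    ∀ᵐ ω ∂μ[|associationEvent P α X k r], ∀ n, exclusionRadius P α k r j ≤ ‖X j n ω‖ := by
  -- No station sits at the origin, by the void probability of a null set; this removes the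
  -- exceptional point of the association event.
  have h0 : ∀ᵐ ω ∂μ, ∀ n, X j n ω ∉ ({0} : Set Plane) := by
    have hm : MeasurableSet {ω | ∀ n, X j n ω ∉ ({0} : Set Plane)} :=
      measurable_pi_lambda (fun ω n => X j n ω) (hnet.ppp j).measurable
        (measurableSet_forall_notMem (measurableSet_singleton 0))
    refine (mem_ae_iff_prob_eq_one hm).2 ?_
    refine ((hnet.ppp j).measure_forall_notMem (measurableSet_singleton 0)).trans ?_
    simp
  filter_upwards [cond_absolutelyContinuous.ae_le h0,
    ae_cond_mem hnet.measurableSet_associationEvent] with ω h1 h2 n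
  rw [associationEvent_eq_inter j] at h2
  exact (exclusionRadius_le_norm_iff hP hα hr j (h1 n)).2 (h2.1 n)

theorem ae_fading_nonneg (hnet : IsTwoTierNetwork X h d M μ) (j : Fin 2) :
    ∀ᵐ ω ∂μ, ∀ n, 0 ≤ h j n ω := by
  refine ae_all_iff.2 fun n => ?_
  have := ae_nonneg_gammaMeasure (M j) (M j)
  rw [← (hnet.fading_law j n).map_eq] at this
  exact ae_of_ae_map (hnet.fading_law j n).aemeasurable this

/-- Almost surely, the interference is finite. -/
theorem ae_tsum_ofReal_ne_top [IsProbabilityMeasure μ] (hnet : IsTwoTierNetwork X h d M μ)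
    (hM : ∀ i, 1 ≤ M i) (hP : ∀ i, 0 < P i) (hα : ∀ i, 0 < α i) (hr : 0 < r) {j : Fin 2}
    (hαj : 2 < α j) :
    ∀ᵐ ω ∂μ[|associationEvent P α X k r],
      ∑' n, ENNReal.ofReal (P j * h j n ω * ‖X j n ω‖ ^ (-α j)) ≠ ∞ := by
  have := cond_isProbabilityMeasure (hnet.measure_associationEvent_ne_zero hP hα hr (k := k))
  set T : Ω → ℝ≥0∞ := fun ω => ∑' n, ENNReal.ofReal (P j * h j n ω * ‖X j n ω‖ ^ (-α j))
  have hT : Measurable T := by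
    refine Measurable.tsum fun n => ?_
    have := hnet.measurable_fading j n
    have := (hnet.ppp j).measurable n
    fun_prop
  have hm : MeasurableSet {ω | T ω ≠ ∞} := (hT (measurableSet_singleton ∞)).compl
  -- From the bound `1 - (1 + x)^{-M} ≤ Mx`: the exponent is at most `d j * s * C`, with `C`
  -- independent of `s`.
  set C : ℝ := P j / M j * (M j *
    ∫ x in {x : Plane | exclusionRadius P α k r j ≤ ‖x‖}, ‖x‖ ^ (-α j))
  have hPj := hP j
  have hle : ∀ s : ℝ, 0 < s → negExp (ENNReal.ofReal (d j) * ENNReal.ofReal (s * C)) ≤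
      μ[|associationEvent P α X k r] {ω | T ω ≠ ∞} := by
    intro s hs
    calc negExp (ENNReal.ofReal (d j) * ENNReal.ofReal (s * C))
        ≤ negExp (ENNReal.ofReal (d j) *
          ∫⁻ x in {x : Plane | exclusionRadius P α k r j ≤ ‖x‖},
            ENNReal.ofReal (1 - ((1 + s * P j / M j * ‖x‖ ^ (-α j)) ^ M j)⁻¹)) := by
          refine antitone_negExp (mul_le_mul_right ((lintegral_norm_ge_radial_le hαj (by positivity)
            (exclusionRadius_pos hP hr j) (M j)).trans_eq ?_) _)
          congr 1
          simp only [C]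
          ring
      _ = ∫⁻ ω, negExp (ENNReal.ofReal s * T ω) ∂μ[|associationEvent P α X k r] :=
          (hnet.lintegral_cond_negExp hM hP hα hr j hs.le).symm
      _ ≤ ∫⁻ ω, {ω | T ω ≠ ∞}.indicator 1 ω ∂μ[|associationEvent P α X k r] := by
          refine lintegral_mono fun ω => ?_
          by_cases hω : T ω = ∞
          -- Here `s > 0` is essential, since `0 * ∞ = 0`.
          · simp [hω, ENNReal.mul_top, hs]
          · rw [Set.indicator_of_mem (by exact hω)]
            exact negExp_le_one _
      _ = _ := lintegral_indicator_one hm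
  have hlim : Tendsto (fun s : ℝ => negExp (ENNReal.ofReal (d j) * ENNReal.ofReal (s * C)))
      (𝓝[>] 0) (𝓝 1) := by
    have h1 : Tendsto (fun s : ℝ => ENNReal.ofReal (s * C)) (𝓝[>] 0) (𝓝 0) := by
      have : Continuous fun s : ℝ => ENNReal.ofReal (s * C) :=
        ENNReal.continuous_ofReal.comp (by fun_prop)
      simpa using (this.tendsto 0).mono_left nhdsWithin_le_nhds
    have h2 := ENNReal.Tendsto.const_mul (a := ENNReal.ofReal (d j)) h1 (Or.inr (by simp))
    simpa [Function.comp_def] using (continuous_negExp.tendsto _).comp h2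
  refine (mem_ae_iff_prob_eq_one hm).2 (le_antisymm prob_le_one ?_)
  exact le_of_tendsto hlim (eventually_nhdsWithin_of_forall hle)

/-- A real `tsum` is `0` without summability; with nonnegative terms, this identifies `interference`
with the sum in `[0, ∞]`. -/
theorem ae_summable [IsProbabilityMeasure μ] (hnet : IsTwoTierNetwork X h d M μ)
    (hM : ∀ i, 1 ≤ M i) (hP : ∀ i, 0 < P i) (hα : ∀ i, 0 < α i) (hr : 0 < r) {j : Fin 2}
    (hαj : 2 < α j) :
    ∀ᵐ ω ∂μ[|associationEvent P α X k r],
      (∀ n, 0 ≤ P j * h j n ω * ‖X j n ω‖ ^ (-α j)) ∧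
        Summable fun n => P j * h j n ω * ‖X j n ω‖ ^ (-α j) := by
  filter_upwards [hnet.ae_tsum_ofReal_ne_top hM hP hα hr hαj,
    cond_absolutelyContinuous.ae_le (hnet.ae_fading_nonneg j)] with ω h1 h2
  have hPj := hP j
  have h3 : ∀ n, 0 ≤ P j * h j n ω * ‖X j n ω‖ ^ (-α j) := fun n => by
    have := h2 n
    positivity
  refine ⟨h3, (ENNReal.summable_toReal h1).congr fun n => ENNReal.toReal_ofReal (h3 n)⟩

theorem integral_cond_exp_interference [IsProbabilityMeasure μ]
    (hnet : IsTwoTierNetwork X h d M μ)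
    (hM : ∀ i, 1 ≤ M i) (hP : ∀ i, 0 < P i) (hα : ∀ i, 0 < α i) (hr : 0 < r) {j : Fin 2}
    (hαj : 2 < α j) {s : ℝ} (hs : 0 ≤ s) :
    ∫ ω, Real.exp (-s * interference P α X h j ω) ∂μ[|associationEvent P α X k r] =
      Real.exp (-(d j * ∫ x in {x : Plane | exclusionRadius P α k r j ≤ ‖x‖},
          (1 - ((1 + s * P j / M j * ‖x‖ ^ (-α j)) ^ M j)⁻¹))) := by
  have hPj := hP j
  have h1 : ∀ᵐ ω ∂μ[|associationEvent P α X k r], Real.exp (-s * interference P α X h j ω) =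
      (negExp (ENNReal.ofReal s *
        ∑' n, ENNReal.ofReal (P j * h j n ω * ‖X j n ω‖ ^ (-α j)))).toReal := by
    filter_upwards [hnet.ae_summable hM hP hα hr hαj] with ω hω
    rw [← ENNReal.ofReal_tsum_of_nonneg hω.1 hω.2, ← ENNReal.ofReal_mul hs,
      negExp_ofReal (mul_nonneg hs (tsum_nonneg hω.1)), ENNReal.toReal_ofReal (Real.exp_pos _).le,
      interference, neg_mul]
  have hm : Measurable fun ω => negExp (ENNReal.ofReal s *
        ∑' n, ENNReal.ofReal (P j * h j n ω * ‖X j n ω‖ ^ (-α j))) := by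
    refine measurable_negExp.comp (Measurable.const_mul (Measurable.tsum fun n => ?_) _)
    have := hnet.measurable_fading j n
    have := (hnet.ppp j).measurable n
    fun_prop
  rw [integral_congr_ae h1, integral_toReal hm.aemeasurable
    (ae_of_all _ fun ω => (negExp_ne_top _).lt_top), hnet.lintegral_cond_negExp hM hP hα hr j hs,
    lintegral_norm_ge_radial hαj (by positivity) (exclusionRadius_pos hP hr j),
    ← ENNReal.ofReal_mul (hnet.ppp j).density_pos.le, negExp_ofReal,
    ENNReal.toReal_ofReal (Real.exp_pos _).le]
  exact mul_nonneg (hnet.ppp j).density_pos.le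
    (integral_nonneg fun x => one_sub_inv_one_add_pow_nonneg (by positivity) _)

end IsTwoTierNetwork

/-! ### The main theorem -/

theorem proposition1 {Ω : Type*} [MeasurableSpace Ω] (μ : Measure Ω) [IsProbabilityMeasure μ]
    (P α lam pa : Fin 2 → ℝ) (M : Fin 2 → ℕ)
    (hP : ∀ i, 0 < P i) (hα : ∀ i, 0 < α i) (hlam : ∀ i, 0 < lam i)
    (hpa : ∀ i, 0 < pa i ∧ pa i ≤ 1) (hM : ∀ i, 1 ≤ M i)
    (X : Fin 2 → ℕ → Ω → Plane) (h : Fin 2 → ℕ → Ω → ℝ)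
    (hnet : IsTwoTierNetwork X h (fun i => pa i * lam i) M μ)
    (k j : Fin 2) (hαj : 2 < α j) (r : ℝ) (hr : 0 < r) :
    μ (associationEvent P α X k r) ≠ 0 ∧
    (∀ᵐ ω ∂μ[|associationEvent P α X k r],
      ∀ n, (P j / P k) ^ (1 / α j) * r ^ (1 / (α j / α k)) ≤ ‖X j n ω‖) ∧
    (∀ᵐ ω ∂μ[|associationEvent P α X k r],
      Summable fun n => P j * h j n ω * ‖X j n ω‖ ^ (-α j)) ∧
    ∀ s : ℝ, 0 ≤ s →
      ((∫ ω, Real.exp (-s * interference P α X h j ω) ∂μ[|associationEvent P α X k r] : ℝ) : ℂ) =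
        Complex.exp
          (-((Real.pi * (pa j * lam j) * (P j / P k) ^ (2 / α j) * r ^ (2 / (α j / α k)) : ℝ) : ℂ) *
            (gaussHypergeometric ((-(2 / α j) : ℝ) : ℂ) (M j : ℂ) ((1 - 2 / α j : ℝ) : ℂ)
              ((-(s * P j / (M j * (P j / P k)) * r ^ (-α k)) : ℝ) : ℂ) - 1)) := by
  refine ⟨hnet.measure_associationEvent_ne_zero hP hα hr, hnet.ae_exclusionRadius_le hP hα hr j,
    (hnet.ae_summable hM hP hα hr hαj).mono fun ω hω => hω.2, fun s hs => ?_⟩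
  have hPj := hP j
  have hPk := hP k
  have hMj : (0 : ℝ) < M j := by exact_mod_cast hM j
  have h1 := ofReal_integral_norm_ge_radial hαj (c := s * P j / M j) (by positivity)
    (exclusionRadius_pos hP hr j (α := α) (k := k)) (M j)
  have h2 : exclusionRadius P α k r j ^ 2 = (P j / P k) ^ (2 / α j) * r ^ (2 / (α j / α k)) := by
    rw [← Real.rpow_natCast, exclusionRadius_rpow hP hr]
    norm_num
  have h3 : s * P j / M j * exclusionRadius P α k r j ^ (-α j) =
      s * P j / (M j * (P j / P k)) * r ^ (-α k) := by
    have hj := (hα j).ne'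
    have hk := (hα k).ne'
    rw [exclusionRadius_rpow hP hr, neg_div, div_self hj, Real.rpow_neg_one,
      show -α j / (α j / α k) = -α k by field_simp]
    field_simp
  rw [h2, h3] at h1
  rw [hnet.integral_cond_exp_interference hM hP hα hr hαj hs, Complex.ofReal_exp,
    Complex.ofReal_neg, Complex.ofReal_mul, h1]
  congr 1
  push_cast
  ring
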